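/- For integers $n\ge 1$ and $0\le m\le\binom n2$ let $G(n,m)$ be a uniformly random simple graph on the vertex set $\{1,\dots,n\}$ with exactly $m$ edges. An event holds with high probability (w.h.p.) if its probability tends to $1$ as $n\to\infty$. There is a sequence $(\varepsilon_k)_{k}$ of real numbers with $\varepsilon_k\to0$ as $k\to\infty$ such that for every integer $k\ge3$ the following two statements hold. (1) For every fixed real number $d>2k\ln k-\ln k-1+\varepsilon_k$, the random graph $G(n,\lceil dn/2\rceil)$ is w.h.p. not $k$-colorable. (2) Let $d_{k-\mathrm{col}}(n)$ be any sharp threshold sequence for $k$-colorability, that is, a sequence of positive real numbers such that for each fixed $\varepsilon>0$ and each sequence $m=m(n)$ of integers with $0\le m\le\binom n2$, $G(n,m)$ is w.h.p. $k$-colorable if $2m/n<(1-\varepsilon)d_{k-\mathrm{col}}(n)$ for all large $n$, and w.h.p. not $k$-colorable if $2m/n>(1+\varepsilon)d_{k-\mathrm{col}}(n)$ for all large $n$. Then $$\limsup_{n\to\infty} d_{k-\mathrm{col}}(n)\le 2k\ln k-\ln k-1+\varepsilon_k .$$ -/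

import Mathlib

open Filter Topology

/-- The law of the random graph `G(n,m)`: a uniformly random simple graph on the vertex set
`Fin n` with exactly `m` edges. (It is a probability measure iff `m ≤ n.choose 2`.) -/
noncomputable def gnm (n m : ℕ) : MeasureTheory.Measure (SimpleGraph (Fin n)) :=
  ProbabilityTheory.uniformOn {G : SimpleGraph (Fin n) | G.edgeSet.ncard = m}

/-- With numbers of edges `m n`, the random graph `G(n, m n)` has the property `P` with high
probability: the probability of `P` tends to `1` as `n → ∞`. -/
def GnmWhp (m : ℕ → ℕ) (P : ∀ n : ℕ, SimpleGraph (Fin n) → Prop) : Prop :=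
  Tendsto (fun n => (gnm n (m n)).real {G | P n G}) atTop (𝓝 1)

/-- `D` is a sharp threshold sequence for `k`-colorability, on the scale of the average degree
`2m/n`: for each fixed `ε > 0`, `G(n,m)` is w.h.p. `k`-colorable if `2m/n < (1-ε) D(n)` and
w.h.p. not `k`-colorable if `2m/n > (1+ε) D(n)`, for arbitrary admissible `m = m(n)`. -/
structure IsSharpColThreshold (k : ℕ) (D : ℕ → ℝ) : Prop where
  pos : ∀ᶠ n in atTop, 0 < D n
  colorable : ∀ ε : ℝ, 0 < ε → ∀ m : ℕ → ℕ, (∀ᶠ n in atTop, m n ≤ n.choose 2) →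
    (∀ᶠ n in atTop, 2 * (m n : ℝ) / (n : ℝ) < (1 - ε) * D n) →
    GnmWhp m (fun _ G => G.Colorable k)
  not_colorable : ∀ ε : ℝ, 0 < ε → ∀ m : ℕ → ℕ, (∀ᶠ n in atTop, m n ≤ n.choose 2) →
    (∀ᶠ n in atTop, (1 + ε) * D n < 2 * (m n : ℝ) / (n : ℝ)) →
    GnmWhp m (fun _ G => ¬ G.Colorable k)

/-! ### Rigid colourings and the generating function of their graphs. -/

section RigidColoring

open Finset

variable {V : Type*} {k : ℕ}

/-! The proof is a first moment bound, applied to rigid colourings instead of all proper ones. Every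
colorable graph has a rigid colouring. Rigidity of σ is a separate condition for each pair (v, j)
with σ v < j, namely that v has a neighbour in the class V_j. Each edge of a properly coloured graph
is seen from exactly one such pair, so the generating function, by number of edges, of the graphs
for which σ is rigid is at most the product of (1 + x)^|V_j| - 1 over these pairs
(`card_isRigidColoring_mul_pow_le`). Dividing by x^m bounds their number.

Put x = y/n, sum over the k^n maps and divide by the number of graphs with m edges. The probability
of colorability is at most exp(n (ln k + B + (d/2)(ln(d/y) - 1) + o(1))), where B bounds `rigidRate
y` over all class densities (`gnmWhp_not_colorable_of_rate`). Take y = ck with c = d/(k-1). Without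
the rigidity gain the exponent is ln k + (d/2) ln(1 - 1/k), which turns negative near d = 2k ln k -
ln k. At equal densities rigidity subtracts e^(-c) (k-1)/2, about 1/(2k) because c is about 2 ln k,
and this yields the further -1. `rigidRate_le` shows that unequal densities cannot spoil the gain.

The statement on threshold sequences follows by playing the two w.h.p. conclusions against each
other (`IsSharpColThreshold.eventually_le`). -/

/-- A proper colouring in which no vertex can be recoloured with a larger colour. -/
def SimpleGraph.IsRigidColoring (G : SimpleGraph V) (σ : V → Fin k) : Prop :=
  (∀ v w, G.Adj v w → σ v ≠ σ w) ∧ ∀ v j, σ v < j → ∃ w, G.Adj v w ∧ σ w = j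

/-- Among proper colourings take one with maximal sum of colours: a vertex that could move to a
larger colour would increase the sum. -/
theorem SimpleGraph.Colorable.exists_isRigidColoring [Fintype V] {G : SimpleGraph V}
    (h : G.Colorable k) : ∃ σ : V → Fin k, G.IsRigidColoring σ := by
  classical
  obtain ⟨C⟩ := h
  let P := {σ : V → Fin k // ∀ v w, G.Adj v w → σ v ≠ σ w}
  have : Nonempty P := ⟨⟨C, fun v w hvw => C.valid hvw⟩⟩
  obtain ⟨⟨σ, hσ⟩, hmax⟩ := Finite.exists_max (fun σ : P => ∑ v, (σ.1 v : ℕ))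
  refine ⟨σ, hσ, fun v j hj => ?_⟩
  by_contra! hcon
  have hproper : ∀ a b, G.Adj a b → Function.update σ v j a ≠ Function.update σ v j b := by
    intro a b hab
    rcases eq_or_ne a v with rfl | ha
    · rw [Function.update_self, Function.update_of_ne hab.ne']
      exact (hcon b hab).symm
    · rcases eq_or_ne b v with rfl | hb
      · rw [Function.update_self, Function.update_of_ne ha]
        exact hcon a hab.symm
      · rw [Function.update_of_ne ha, Function.update_of_ne hb]
        exact hσ a b hab
  have h1 := hmax ⟨_, hproper⟩
  refine absurd h1 (not_le.2 (Finset.sum_lt_sum (fun a _ => ?_) ⟨v, mem_univ v, ?_⟩))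
  · rcases eq_or_ne a v with rfl | ha
    · simpa using hj.le
    · simp [Function.update_of_ne ha]
  · simpa using hj

variable [Fintype V]

open scoped Classical in
/-- For a pair `(v, j)` with `σ v < j`, the neighbours of `v` of colour `j`. -/
noncomputable def SimpleGraph.upNeighbors (G : SimpleGraph V) (σ : V → Fin k) (p : V × Fin k) :
    Finset V :=
  {w | G.Adj p.1 w ∧ σ w = p.2 ∧ σ p.1 < p.2}

theorem SimpleGraph.sum_card_upNeighbors {G : SimpleGraph V} {σ : V → Fin k}
    (hσ : ∀ v w, G.Adj v w → σ v ≠ σ w) :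
    ∑ p, #(G.upNeighbors σ p) = G.edgeSet.ncard := by
  classical
  have h1 : ∑ p, #(G.upNeighbors σ p) =
      ∑ v, ∑ w, if G.Adj v w ∧ σ v < σ w then 1 else 0 := by
    simp only [SimpleGraph.upNeighbors, Fintype.sum_prod_type, card_filter]
    refine sum_congr rfl fun v _ => ?_
    rw [sum_comm]
    refine sum_congr rfl fun w _ => ?_
    rw [sum_eq_single (σ w)]
    · simp
    · intro j _ hj
      simp [hj.symm]
    · simp
  have h2 : ∑ v, ∑ w, (if G.Adj v w ∧ σ v < σ w then 1 else 0) =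
      ∑ v, ∑ w, if G.Adj v w ∧ σ w < σ v then 1 else 0 := by
    rw [sum_comm]
    simp only [G.adj_comm]
  have h3 : ∑ v, ∑ w, (if G.Adj v w ∧ σ v < σ w then 1 else 0) +
      ∑ v, ∑ w, (if G.Adj v w ∧ σ w < σ v then 1 else 0) = ∑ v, G.degree v := by
    simp only [← sum_add_distrib]
    refine sum_congr rfl fun v _ => ?_
    rw [← G.card_neighborFinset_eq_degree, G.neighborFinset_eq_filter, card_filter]
    refine sum_congr rfl fun w _ => ?_
    by_cases hvw : G.Adj v w
    · rcases lt_or_gt_of_ne (hσ v w hvw) with h | h <;> simp [hvw, h, h.le]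
    · simp [hvw]
  rw [G.sum_degrees_eq_twice_card_edges] at h3
  rw [h1, ← SimpleGraph.coe_edgeFinset, Set.ncard_coe_finset]
  omega

theorem SimpleGraph.eq_of_upNeighbors_eq {G H : SimpleGraph V} {σ : V → Fin k}
    (hG : ∀ v w, G.Adj v w → σ v ≠ σ w) (hH : ∀ v w, H.Adj v w → σ v ≠ σ w)
    (h : G.upNeighbors σ = H.upNeighbors σ) : G = H := by
  have key : ∀ v w, σ v < σ w → (G.Adj v w ↔ H.Adj v w) := by
    intro v w hvw
    have := congrArg (fun s => w ∈ s (v, σ w)) h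
    simpa [SimpleGraph.upNeighbors, hvw] using this
  ext v w
  rcases lt_trichotomy (σ v) (σ w) with hvw | hvw | hvw
  · exact key v w hvw
  · exact ⟨fun h' => absurd hvw (hG v w h'), fun h' => absurd hvw (hH v w h')⟩
  · rw [G.adj_comm, H.adj_comm]
    exact key w v hvw

open scoped Classical in
-- A graph is determined by its family of up-neighbour sets, whose sizes add up to m; rigidity makes
-- each of them a nonempty subset of a colour class. Expanding the product sums x^(total size) over
-- all such families.
theorem card_isRigidColoring_mul_pow_le (σ : V → Fin k) (m : ℕ) {x : ℝ} (hx : 0 ≤ x) :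
    (#{G : SimpleGraph V | G.edgeSet.ncard = m ∧ G.IsRigidColoring σ} : ℝ) * x ^ m ≤
      ∏ p : V × Fin k, if σ p.1 < p.2 then (1 + x) ^ #{w | σ w = p.2} - 1 else 1 := by
  let t : V × Fin k → Finset (Finset V) := fun p =>
    -- Pairs with σ v ≥ j have no up-neighbours; the choice {∅} gives them the factor 1.
    if σ p.1 < p.2 then ({w | σ w = p.2} : Finset V).powerset.erase ∅ else {∅}
  have hprod : ∀ p : V × Fin k, (if σ p.1 < p.2 then (1 + x) ^ #{w | σ w = p.2} - 1 else 1) =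
      ∑ s ∈ t p, x ^ #s := by
    intro p
    simp only [t]
    split_ifs with hp
    · have h := Finset.sum_pow_mul_eq_add_pow x 1 ({w | σ w = p.2} : Finset V)
      rw [← Finset.add_sum_erase _ _ (empty_mem_powerset _)] at h
      simp only [one_pow, mul_one, card_empty, pow_zero] at h
      rw [add_comm 1 x, ← h]
      ring
    · simp
  simp_rw [hprod]
  rw [prod_univ_sum]
  rw [← nsmul_eq_mul, ← sum_const]
  have hinj : Set.InjOn (fun G : SimpleGraph V => G.upNeighbors σ)
      (({G : SimpleGraph V | G.edgeSet.ncard = m ∧ G.IsRigidColoring σ} : Finset _) : Set _) := by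
    intro G hG H hH h
    simp only [coe_filter, mem_univ, true_and, Set.mem_ofPred_eq] at hG hH
    exact SimpleGraph.eq_of_upNeighbors_eq hG.2.1 hH.2.1 h
  calc _ = ∑ G : SimpleGraph V with G.edgeSet.ncard = m ∧ G.IsRigidColoring σ,
        ∏ p, x ^ #(G.upNeighbors σ p) := by
        refine sum_congr rfl fun G hG => ?_
        simp only [mem_filter, mem_univ, true_and] at hG
        rw [prod_pow_eq_pow_sum, SimpleGraph.sum_card_upNeighbors hG.2.1, hG.1]
    _ = ∑ f ∈ ({G : SimpleGraph V | G.edgeSet.ncard = m ∧ G.IsRigidColoring σ} :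
          Finset (SimpleGraph V)).image (fun G => G.upNeighbors σ), ∏ p, x ^ #(f p) := by
        rw [sum_image hinj]
    _ ≤ _ := by
        refine sum_le_sum_of_subset_of_nonneg ?_ fun f _ _ => prod_nonneg fun p _ => by positivity
        intro f hf
        simp only [mem_image, mem_filter, mem_univ, true_and] at hf
        obtain ⟨G, ⟨-, hG⟩, rfl⟩ := hf
        rw [Fintype.mem_piFinset]
        intro p
        simp only [t]
        split_ifs with hp
        · rw [mem_erase, mem_powerset, ← nonempty_iff_ne_empty]
          constructor
          · obtain ⟨w, hw, hw'⟩ := hG.2 p.1 p.2 hp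
            exact ⟨w, by simp [SimpleGraph.upNeighbors, hw, hw', hp]⟩
          · intro w hw
            simp only [SimpleGraph.upNeighbors, mem_filter, mem_univ, true_and] at hw ⊢
            exact hw.2.1
        · simp [SimpleGraph.upNeighbors, hp]

/-- With t = xa: (1 + x)^a - 1 ≤ e^t (1 - e^(-t)) ≤ exp(t - e^(-t)). -/
theorem one_add_pow_sub_one_le_exp {x : ℝ} (hx : 0 ≤ x) (a : ℕ) :
    (1 + x) ^ a - 1 ≤ Real.exp (x * a - Real.exp (-(x * a))) := by
  have h1 : (1 + x) ^ a ≤ Real.exp (x * a) := by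
    rw [mul_comm, Real.exp_nat_mul]
    gcongr
    linarith [Real.add_one_le_exp x]
  have h2 := Real.add_one_le_exp (-Real.exp (-(x * a)))
  have h3 : Real.exp (x * a) * Real.exp (-(x * a)) = 1 := by
    rw [← Real.exp_add]; simp
  rw [sub_eq_add_neg (x * a), Real.exp_add]
  have h4 := mul_le_mul_of_nonneg_left h2 (Real.exp_pos (x * a)).le
  rw [mul_add, mul_neg, h3] at h4
  linarith

/-- The exponential rate of the expected number of rigid colourings with class densities `a`,
apart from the contribution of the number of edges. -/
noncomputable def rigidRate (y : ℝ) (a : Fin k → ℝ) : ℝ :=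
  ∑ i, ∑ j, if i < j then a i * (y * a j - Real.exp (-(y * a j))) else 0

open scoped Classical in
theorem prod_classes_le_exp_rigidRate [Nonempty V] (σ : V → Fin k) {y : ℝ} (hy : 0 ≤ y) :
    (∏ p : V × Fin k,
      if σ p.1 < p.2 then (1 + y / Fintype.card V) ^ #{w | σ w = p.2} - 1 else 1) ≤
      Real.exp (Fintype.card V *
        rigidRate y fun i => (#{w | σ w = i} : ℝ) / Fintype.card V) := by
  set n : ℝ := (Fintype.card V : ℝ) with hn
  have hn0 : 0 < n := by rw [hn]; exact_mod_cast Fintype.card_pos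
  have hx : 0 ≤ y / n := by positivity
  set g : Fin k → ℝ := fun j => y / n * #{w | σ w = j} - Real.exp (-(y / n * #{w | σ w = j}))
  have hsum : n * rigidRate y (fun i => (#{w | σ w = i} : ℝ) / n) =
      ∑ p : V × Fin k, if σ p.1 < p.2 then g p.2 else 0 := by
    rw [Fintype.sum_prod_type, rigidRate, mul_sum,
      ← sum_fiberwise (s := univ) (g := σ) (f := fun v => ∑ j, if σ v < j then g j else 0)]
    refine sum_congr rfl fun i _ => ?_
    have : ∀ v ∈ ({v | σ v = i} : Finset V), (∑ j, if σ v < j then g j else 0) =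
        ∑ j, if i < j then g j else 0 := by
      intro v hv
      rw [(mem_filter.1 hv).2]
    rw [sum_congr rfl this, sum_const, nsmul_eq_mul, mul_sum, mul_sum]
    refine sum_congr rfl fun j _ => ?_
    simp only [g]
    split_ifs
    · field_simp
    · simp
  rw [hsum, Real.exp_sum]
  refine prod_le_prod (fun p _ => ?_) fun p _ => ?_
  · split_ifs
    · exact sub_nonneg.2 (one_le_pow₀ (by linarith))
    · exact zero_le_one
  · split_ifs
    · exact one_add_pow_sub_one_le_exp hx _
    · simp

open scoped Classical in
theorem card_colorable_mul_pow_le [Nonempty V] (m : ℕ) {y B : ℝ} (hy : 0 ≤ y)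
    (hB : ∀ a : Fin k → ℝ, (∀ i, 0 ≤ a i) → ∑ i, a i = 1 → rigidRate y a ≤ B) :
    (#{G : SimpleGraph V | G.edgeSet.ncard = m ∧ G.Colorable k} : ℝ) *
      (y / Fintype.card V) ^ m ≤ (k : ℝ) ^ Fintype.card V * Real.exp (Fintype.card V * B) := by
  have hn0 : 0 < (Fintype.card V : ℝ) := by exact_mod_cast Fintype.card_pos
  have hsub : ({G : SimpleGraph V | G.edgeSet.ncard = m ∧ G.Colorable k} : Finset _) ⊆
      (univ : Finset (V → Fin k)).biUnion
        fun σ => {G : SimpleGraph V | G.edgeSet.ncard = m ∧ G.IsRigidColoring σ} := by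
    intro G hG
    simp only [mem_filter, mem_univ, true_and, mem_biUnion] at hG ⊢
    obtain ⟨σ, hσ⟩ := hG.2.exists_isRigidColoring
    exact ⟨σ, hG.1, hσ⟩
  have hx : 0 ≤ y / Fintype.card V := by positivity
  calc _ ≤ (∑ σ : V → Fin k,
          (#{G : SimpleGraph V | G.edgeSet.ncard = m ∧ G.IsRigidColoring σ} : ℝ)) *
          (y / Fintype.card V) ^ m := by
        gcongr
        exact_mod_cast (card_le_card hsub).trans card_biUnion_le
    _ = ∑ σ : V → Fin k,
          (#{G : SimpleGraph V | G.edgeSet.ncard = m ∧ G.IsRigidColoring σ} : ℝ) *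
          (y / Fintype.card V) ^ m := sum_mul ..
    _ ≤ ∑ σ : V → Fin k, Real.exp (Fintype.card V * B) := by
        refine sum_le_sum fun σ _ => ?_
        refine ((card_isRigidColoring_mul_pow_le σ m hx).trans
          (prod_classes_le_exp_rigidRate σ hy)).trans ?_
        gcongr
        refine hB _ (fun i => by positivity) ?_
        rw [← sum_div, ← Nat.cast_sum, ← card_eq_sum_card_fiberwise (fun _ _ => mem_univ _),
          card_univ, div_self hn0.ne']
    _ = _ := by simp

end RigidColoring

/-! ### The first moment bound in G(n,m) and its exponential rate. -/

section UniformGraph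

open Finset

/-- An edge set determines its graph. Measurable singletons let `uniformOn` be computed as a ratio
of cardinalities. -/
instance {V : Type*} [Countable V] : MeasurableSingletonClass (SimpleGraph V) where
  measurableSet_singleton G := by
    have : ({G} : Set (SimpleGraph V)) = SimpleGraph.edgeSet ⁻¹' {G.edgeSet} := by
      ext H; simp
    rw [this]
    exact SimpleGraph.measurable_edgeSet (measurableSet_singleton _)

open scoped Classical in
theorem choose_le_card_simpleGraph {V : Type*} [Fintype V] (m : ℕ) :
    ((Fintype.card V).choose 2).choose m ≤ #{G : SimpleGraph V | G.edgeSet.ncard = m} := by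
  rw [← SimpleGraph.card_edgeFinset_top_eq_card_choose_two, ← card_powersetCard]
  have key : ∀ s ∈ powersetCard m (⊤ : SimpleGraph V).edgeFinset,
      (SimpleGraph.fromEdgeSet (s : Set (Sym2 V))).edgeSet = s := by
    intro s hs
    rw [SimpleGraph.edgeSet_fromEdgeSet, sdiff_eq_left, Set.disjoint_left]
    intro e he he'
    have := (mem_powersetCard.1 hs).1 he
    rw [SimpleGraph.mem_edgeFinset] at this
    exact SimpleGraph.not_isDiag_of_mem_edgeSet _ this he'
  refine card_le_card_of_injOn (fun s => SimpleGraph.fromEdgeSet (s : Set (Sym2 V))) ?_ ?_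
  · intro s hs
    simp only [coe_filter, mem_univ, true_and, Set.mem_ofPred_eq]
    rw [key s hs, Set.ncard_coe_finset, (mem_powersetCard.1 hs).2]
  · intro s hs t ht h
    have h' := congrArg SimpleGraph.edgeSet h
    simp only at h'
    rw [key s hs, key t ht] at h'
    exact_mod_cast h'

open scoped Classical in
theorem isProbabilityMeasure_gnm {n m : ℕ} (h : m ≤ n.choose 2) :
    MeasureTheory.IsProbabilityMeasure (gnm n m) := by
  refine ProbabilityTheory.isProbabilityMeasure_uniformOn (Set.toFinite _) ?_
  have h1 := choose_le_card_simpleGraph (V := Fin n) m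
  rw [Fintype.card_fin] at h1
  obtain ⟨G, hG⟩ := card_pos.1 ((Nat.choose_pos h).trans_le h1)
  exact ⟨G, by simpa using hG⟩

open scoped Classical in
theorem gnm_real_setOf (n m : ℕ) (P : SimpleGraph (Fin n) → Prop) :
    (gnm n m).real {G | P G} = (#{G : SimpleGraph (Fin n) | G.edgeSet.ncard = m ∧ P G} : ℝ) /
      #{G : SimpleGraph (Fin n) | G.edgeSet.ncard = m} := by
  have h := ProbabilityTheory.uniformOn_apply_finset
    (s := ({G : SimpleGraph (Fin n) | G.edgeSet.ncard = m} : Finset _))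
    (t := ({G : SimpleGraph (Fin n) | P G} : Finset _))
  rw [← filter_and] at h
  simp only [coe_filter, mem_univ, true_and] at h
  rw [MeasureTheory.measureReal_def, gnm, h, ENNReal.toReal_div, ENNReal.toReal_natCast,
    ENNReal.toReal_natCast]

theorem gnm_real_not {n m : ℕ} (h : m ≤ n.choose 2) (P : SimpleGraph (Fin n) → Prop) :
    (gnm n m).real {G | ¬ P G} = 1 - (gnm n m).real {G | P G} := by
  have := isProbabilityMeasure_gnm h
  exact MeasureTheory.probReal_compl_eq_one_sub (Set.toFinite {G | P G}).measurableSet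

theorem gnm_real_colorable_le {k n m : ℕ} (hn : 0 < n) (h : m ≤ n.choose 2) {y B : ℝ} (hy : 0 < y)
    (hB : ∀ a : Fin k → ℝ, (∀ i, 0 ≤ a i) → ∑ i, a i = 1 → rigidRate y a ≤ B) :
    (gnm n m).real {G | G.Colorable k} ≤
      (k : ℝ) ^ n * Real.exp (n * B) * (n / y) ^ m * m.factorial /
        ((n.choose 2 : ℝ) + 1 - m) ^ m := by
  classical
  have : Nonempty (Fin n) := ⟨⟨0, hn⟩⟩
  have hn' : (0 : ℝ) < n := by exact_mod_cast hn
  have h1 : (#{G : SimpleGraph (Fin n) | G.edgeSet.ncard = m ∧ G.Colorable k} : ℝ) *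
      (y / n) ^ m ≤ (k : ℝ) ^ n * Real.exp (n * B) := by
    have := card_colorable_mul_pow_le (V := Fin n) (k := k) m hy.le hB
    rw [Fintype.card_fin] at this
    convert this
  have h2 : (n.choose 2).choose m ≤ #{G : SimpleGraph (Fin n) | G.edgeSet.ncard = m} := by
    have := choose_le_card_simpleGraph (V := Fin n) m
    rw [Fintype.card_fin] at this
    convert this
  have h3 := Nat.pow_le_choose (α := ℝ) m (n.choose 2)
  rw [Nat.cast_sub (by omega), Nat.cast_add, Nat.cast_one] at h3
  have hm : (m : ℝ) ≤ n.choose 2 := by exact_mod_cast h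
  have hpos : 0 < ((n.choose 2 : ℝ) + 1 - m) ^ m := pow_pos (by linarith) m
  have hf : (0 : ℝ) < m.factorial := by exact_mod_cast m.factorial_pos
  rw [gnm_real_setOf]
  generalize (#{G : SimpleGraph (Fin n) | G.edgeSet.ncard = m} : ℕ) = T at h2 ⊢
  have h4 := h3.trans (Nat.cast_le.2 h2)
  generalize (#{G : SimpleGraph (Fin n) | G.edgeSet.ncard = m ∧ G.Colorable k} : ℕ) = A at h1 ⊢
  have hA : (A : ℝ) ≤ (k : ℝ) ^ n * Real.exp (n * B) * (n / y) ^ m := by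
    have e : (n / y : ℝ) ^ m = ((y / n) ^ m)⁻¹ := by rw [← inv_pow, inv_div]
    rw [e, ← div_eq_mul_inv, le_div_iff₀ (by positivity)]
    exact h1
  calc _ ≤ A / (((n.choose 2 : ℝ) + 1 - m) ^ m / m.factorial) := by
        exact div_le_div_of_nonneg_left (by positivity) (by positivity) h4
    _ = A * m.factorial / ((n.choose 2 : ℝ) + 1 - m) ^ m := by field_simp
    _ ≤ _ := by gcongr

/-- Cruder than Stirling by a term of order ln m, which vanishes after division by n. -/
theorem log_factorial_le {m : ℕ} (hm : 1 ≤ m) :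
    Real.log m.factorial ≤ (m + 1) * Real.log m - m + 1 := by
  induction m, hm using Nat.le_induction with
  | base => simp
  | succ m hm ih =>
    have hm0 : (0 : ℝ) < m := by exact_mod_cast hm
    rw [Nat.factorial_succ, Nat.cast_mul,
      Real.log_mul (by positivity) (by exact_mod_cast m.factorial_ne_zero)]
    push_cast
    have h1 := Real.log_le_sub_one_of_pos (x := (m : ℝ) / (m + 1)) (by positivity)
    rw [Real.log_div (by positivity) (by positivity)] at h1
    have h2 : ((m : ℝ) + 1) * (Real.log m - Real.log (m + 1)) ≤ (m + 1) * (m / (m + 1) - 1) := by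
      gcongr
    have h3 : ((m : ℝ) + 1) * (m / (m + 1) - 1) = -1 := by field_simp; ring
    nlinarith

theorem tendsto_ceil_div {d : ℝ} (hd : 0 ≤ d) :
    Tendsto (fun n : ℕ => (⌈d * (n : ℝ) / 2⌉₊ : ℝ) / n) atTop (𝓝 (d / 2)) := by
  have := (tendsto_nat_ceil_mul_div_atTop (R := ℝ) (a := d / 2) (by positivity)).comp
    tendsto_natCast_atTop_atTop
  refine this.congr fun n => ?_
  simp only [Function.comp]
  rw [div_mul_eq_mul_div]

theorem tendsto_choose_two_sub_ceil_div {d : ℝ} (hd : 0 ≤ d) :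
    Tendsto (fun n : ℕ => ((n.choose 2 : ℝ) + 1 - ⌈d * (n : ℝ) / 2⌉₊) / (n : ℝ) ^ 2) atTop
      (𝓝 (1 / 2)) := by
  have h1 := tendsto_ceil_div hd
  have h2 : Tendsto (fun n : ℕ => 1 / (n : ℝ)) atTop (𝓝 0) := tendsto_one_div_atTop_nhds_zero_nat
  have h3 := ((tendsto_const_nhds (x := (1 / 2 : ℝ))).sub (h2.const_mul (1 / 2))).add
    ((h2.mul h2).sub (h1.mul h2))
  simp only [mul_zero, sub_zero, add_zero] at h3
  refine h3.congr' ?_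
  filter_upwards [eventually_gt_atTop 0] with n hn
  have hn' : (0 : ℝ) < n := by exact_mod_cast hn
  rw [Nat.cast_choose_two]
  field_simp
  ring

theorem eventually_ceil_le_choose_two {d : ℝ} (hd : 0 ≤ d) :
    ∀ᶠ n : ℕ in atTop, ⌈d * (n : ℝ) / 2⌉₊ ≤ n.choose 2 := by
  filter_upwards [(tendsto_choose_two_sub_ceil_div hd).eventually (lt_mem_nhds one_half_pos),
    eventually_gt_atTop 0] with n hn hn0
  have hn' : (0 : ℝ) < n := by exact_mod_cast hn0
  have : (0 : ℝ) < (n.choose 2 : ℝ) + 1 - ⌈d * (n : ℝ) / 2⌉₊ := by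
    by_contra! hcon
    exact absurd (div_nonpos_of_nonpos_of_nonneg hcon (by positivity)) (not_le.2 hn)
  have : (⌈d * (n : ℝ) / 2⌉₊ : ℝ) < ((n.choose 2 + 1 : ℕ) : ℝ) := by push_cast; linarith
  have := Nat.cast_lt.1 this
  omega

theorem gnmWhp_not_colorable_of_rate {k : ℕ} (hk : 0 < k) {d y B : ℝ} (hd : 0 < d) (hy : 0 < y)
    (hB : ∀ a : Fin k → ℝ, (∀ i, 0 ≤ a i) → ∑ i, a i = 1 → rigidRate y a ≤ B)
    (hneg : Real.log k + B + d / 2 * (Real.log (d / y) - 1) < 0) :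
    GnmWhp (fun n => ⌈d * (n : ℝ) / 2⌉₊) (fun _ G => ¬ G.Colorable k) := by
  set M : ℕ → ℕ := fun n => ⌈d * (n : ℝ) / 2⌉₊
  set K : ℕ → ℝ := fun n => (n.choose 2 : ℝ) + 1 - M n
  have hk' : (0 : ℝ) < k := by exact_mod_cast hk
  have hM : Tendsto (fun n : ℕ => (M n : ℝ) / n) atTop (𝓝 (d / 2)) := tendsto_ceil_div hd.le
  have hK : Tendsto (fun n : ℕ => K n / (n : ℝ) ^ 2) atTop (𝓝 (1 / 2)) :=
    tendsto_choose_two_sub_ceil_div hd.le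
  -- 1/n times the logarithm of the bound, with m! estimated by `log_factorial_le`; the last bracket
  -- is its vanishing error.
  let r : ℕ → ℝ := fun n => Real.log k + B +
    (M n : ℝ) / n * (Real.log ((M n : ℝ) / n / (y * (K n / (n : ℝ) ^ 2))) - 1) +
    (Real.log ((M n : ℝ) / n) * (1 / n) + Real.log n / n + 1 / n)
  have h0 : Tendsto (fun n : ℕ => 1 / (n : ℝ)) atTop (𝓝 0) := tendsto_one_div_atTop_nhds_zero_nat
  have hlog : Tendsto (fun n : ℕ => Real.log n / (n : ℝ)) atTop (𝓝 0) :=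
    Real.isLittleO_log_id_atTop.tendsto_div_nhds_zero.comp tendsto_natCast_atTop_atTop
  have hr : Tendsto r atTop (𝓝 (Real.log k + B + d / 2 * (Real.log (d / y) - 1))) := by
    have h1 : Tendsto (fun n => Real.log ((M n : ℝ) / n / (y * (K n / (n : ℝ) ^ 2)))) atTop
        (𝓝 (Real.log (d / y))) := by
      have e : d / y = d / 2 / (y * (1 / 2)) := by field_simp
      rw [e]
      exact (hM.div (hK.const_mul y) (by positivity)).log (by positivity)
    have h2 := (tendsto_const_nhds (x := Real.log k + B)).add (hM.mul (h1.sub_const 1))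
    have h3 := ((hM.log (by positivity)).mul h0).add hlog |>.add h0
    simpa [r] using h2.add h3
  obtain ⟨c, hc1, hc2⟩ := exists_between hneg
  have hbound : ∀ᶠ n : ℕ in atTop, (gnm n (M n)).real {G | G.Colorable k} ≤ Real.exp (n * c) := by
    filter_upwards [eventually_ceil_le_choose_two hd.le, eventually_gt_atTop 0,
      hr.eventually (gt_mem_nhds hc1)] with n hle hn hrn
    have hn' : (0 : ℝ) < n := by exact_mod_cast hn
    have hMn : 0 < M n := Nat.ceil_pos.2 (by positivity)
    have hMn' : (0 : ℝ) < M n := by exact_mod_cast hMn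
    have hle' : (M n : ℝ) ≤ n.choose 2 := by exact_mod_cast hle
    have hKn : 0 < K n := by simp only [K]; linarith
    have hf : (0 : ℝ) < (M n).factorial := by exact_mod_cast (M n).factorial_pos
    refine (gnm_real_colorable_le hn hle hy hB).trans ?_
    rw [← Real.log_le_log_iff (by positivity) (Real.exp_pos _), Real.log_exp]
    have hlf := log_factorial_le (m := M n) hMn
    change Real.log ((k : ℝ) ^ n * Real.exp (n * B) * (n / y) ^ M n * (M n).factorial /
        K n ^ M n) ≤ n * c
    rw [Real.log_div (by positivity) (by positivity), Real.log_mul (by positivity) (by positivity),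
      Real.log_mul (by positivity) (by positivity), Real.log_mul (by positivity) (by positivity),
      Real.log_pow, Real.log_pow, Real.log_pow, Real.log_exp, Real.log_div hn'.ne' hy.ne']
    have hrn' : n * r n ≤ n * c := by gcongr
    refine le_trans ?_ hrn'
    have e : n * r n = n * Real.log k + n * B + M n * (Real.log n - Real.log y) +
        ((M n + 1) * Real.log (M n) - M n + 1) - M n * Real.log (K n) := by
      simp only [r]
      rw [Real.log_div (x := (M n : ℝ) / n) (by positivity) (by positivity),
        Real.log_mul hy.ne' (by positivity), Real.log_div hKn.ne' (by positivity), Real.log_pow,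
        Real.log_div hMn'.ne' hn'.ne']
      field_simp
      push_cast
      ring
    rw [e]
    linarith
  have hexp : Tendsto (fun n : ℕ => Real.exp (n * c)) atTop (𝓝 0) :=
    Real.tendsto_exp_atBot.comp (tendsto_natCast_atTop_atTop.atTop_mul_const_of_neg hc2)
  have hzero : Tendsto (fun n : ℕ => (gnm n (M n)).real {G | G.Colorable k}) atTop (𝓝 0) :=
    squeeze_zero' (.of_forall fun _ => MeasureTheory.measureReal_nonneg) hbound hexp
  have hone := hzero.const_sub 1
  rw [sub_zero] at hone
  refine hone.congr' ?_
  filter_upwards [eventually_ceil_le_choose_two hd.le] with n hle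
  exact (gnm_real_not hle _).symm

end UniformGraph

/-! ### Maximising the rate over class densities. -/

section RateBounds

open Finset

variable {k : ℕ}

theorem sum_sum_ite_lt_left (f : Fin k → ℝ) :
    ∑ i, ∑ j, (if i < j then f i else 0) = ∑ i : Fin k, ((k : ℝ) - 1 - (i : ℕ)) * f i := by
  refine sum_congr rfl fun i _ => ?_
  rw [← sum_filter, sum_const, filter_lt_eq_Ioi, Fin.card_Ioi, nsmul_eq_mul]
  have := i.2
  rw [Nat.sub_sub, Nat.cast_sub (by omega)]
  push_cast
  ring

theorem sum_sum_ite_lt_right (f : Fin k → ℝ) :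
    ∑ i, ∑ j, (if i < j then f j else 0) = ∑ j : Fin k, (j : ℕ) * f j := by
  rw [sum_comm]
  refine sum_congr rfl fun j _ => ?_
  rw [← sum_filter, sum_const, nsmul_eq_mul]
  congr 2
  rw [filter_gt_eq_Iio, Fin.card_Iio]

theorem two_mul_sum_sum_ite_lt_mul (f : Fin k → ℝ) :
    2 * ∑ i, ∑ j, (if i < j then f i * f j else 0) = (∑ i, f i) ^ 2 - ∑ i, f i ^ 2 := by
  have h1 : ∑ i, ∑ j, (if i < j then f i * f j else 0) =
      ∑ i, ∑ j, if j < i then f i * f j else 0 := by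
    rw [sum_comm]
    simp only [mul_comm]
  have h2 : (∑ i, f i) ^ 2 = ∑ i, ∑ j, (if i < j then f i * f j else 0) +
      ∑ i, ∑ j, (if j < i then f i * f j else 0) + ∑ i, f i ^ 2 := by
    rw [sq, sum_mul_sum, ← sum_add_distrib, ← sum_add_distrib]
    refine sum_congr rfl fun i _ => ?_
    rw [← sum_add_distrib]
    have : f i ^ 2 = ∑ j, if i = j then f i * f j else 0 := by simp [sq]
    rw [this, ← sum_add_distrib]
    refine sum_congr rfl fun j _ => ?_
    rcases lt_trichotomy i j with h | h | h
    · simp [h, h.ne, h.le]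
    · simp [h]
    · simp [h, h.ne', h.le]
  rw [h2, ← h1]
  ring

theorem rigidRate_eq (y : ℝ) {a : Fin k → ℝ} (ha : ∑ i, a i = 1) :
    rigidRate y a = y * (1 - ∑ i, a i ^ 2) / 2 -
      ∑ i, ∑ j, if i < j then a i * Real.exp (-(y * a j)) else 0 := by
  have h := two_mul_sum_sum_ite_lt_mul a
  rw [ha, one_pow] at h
  rw [← h, mul_left_comm, mul_div_cancel_left₀ _ two_ne_zero, rigidRate, mul_sum,
    ← sum_sub_distrib]
  refine sum_congr rfl fun i _ => ?_
  rw [mul_sum, ← sum_sub_distrib]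
  refine sum_congr rfl fun j _ => ?_
  split_ifs
  · ring
  · simp

theorem rigidRate_le_half {c : ℝ} (hc : 0 ≤ c) (hk : 0 < k) {a : Fin k → ℝ} (ha0 : ∀ i, 0 ≤ a i)
    (ha : ∑ i, a i = 1) : rigidRate (c * k) a ≤ c * (k - 1) / 2 := by
  have hk' : (0 : ℝ) < k := by exact_mod_cast hk
  have h1 : 0 ≤ ∑ i, ∑ j, if i < j then a i * Real.exp (-(c * k * a j)) else 0 := by
    refine sum_nonneg fun i _ => sum_nonneg fun j _ => ?_
    split_ifs
    · exact mul_nonneg (ha0 i) (Real.exp_pos _).le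
    · exact le_rfl
  have h2 := sq_sum_le_card_mul_sum_sq (s := univ) (f := a)
  rw [ha, card_univ, Fintype.card_fin, one_pow] at h2
  rw [rigidRate_eq _ ha]
  have h3 := mul_le_mul_of_nonneg_left h2 hc
  nlinarith

/-- With a_i = (1 + u_i)/k and Q = Σ u_i², imbalance costs cQ/(2k) in the quadratic term. Either
this alone pays for τ, or Q < 1 and the exponential sum is close to its balanced value. -/
theorem rigidRate_le {c τ : ℝ} (hc : 0 ≤ c) (hk : 0 < k) (hτc : τ ≤ c)
    (hτ : τ ≤ Real.exp (-c) * (k * (k - 1) - 2 * (1 + c) * (k * √k)))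
    {a : Fin k → ℝ} (ha0 : ∀ i, 0 ≤ a i) (ha : ∑ i, a i = 1) :
    rigidRate (c * k) a ≤ c * (k - 1) / 2 - τ / (2 * k) := by
  have hk' : (0 : ℝ) < k := by exact_mod_cast hk
  obtain ⟨u, hu⟩ : ∃ u : Fin k → ℝ, ∀ i, a i = (1 + u i) / k :=
    ⟨fun i => k * a i - 1, fun i => by field_simp; ring⟩
  have hu0 : ∑ i, u i = 0 := by
    simp only [hu, ← sum_div, sum_add_distrib, sum_const, card_univ, Fintype.card_fin,
      nsmul_eq_mul, mul_one] at ha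
    rw [div_eq_iff hk'.ne'] at ha
    linarith
  set Q := ∑ i, u i ^ 2 with hQ
  have hQ0 : 0 ≤ Q := sum_nonneg fun i _ => sq_nonneg _
  have hs : ∑ i, a i ^ 2 = (k + Q) / k ^ 2 := by
    have : ∀ i, a i ^ 2 = (1 + 2 * u i + u i ^ 2) / k ^ 2 := fun i => by
      rw [hu]; field_simp; ring
    simp only [this, ← sum_div, sum_add_distrib, ← mul_sum, hu0, sum_const, card_univ,
      Fintype.card_fin, nsmul_eq_mul, mul_one, mul_zero, add_zero, hQ]
  rw [rigidRate_eq _ ha, hs]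
  set R := ∑ i, ∑ j, if i < j then a i * Real.exp (-(c * k * a j)) else 0 with hR
  have hmain : c * k * (1 - (k + Q) / k ^ 2) / 2 = c * (k - 1) / 2 - c * Q / (2 * k) := by
    field_simp
    ring
  have hR0 : 0 ≤ R := by
    refine sum_nonneg fun i _ => sum_nonneg fun j _ => ?_
    split_ifs
    · exact mul_nonneg (ha0 i) (Real.exp_pos _).le
    · exact le_rfl
  suffices h : τ ≤ c * Q + 2 * k * R by
    have : τ / (2 * k) ≤ c * Q / (2 * k) + R := by
      rw [div_add' _ _ _ (by positivity), div_le_div_iff_of_pos_right (by positivity)]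
      linarith
    rw [hmain]
    linarith
  rcases le_or_gt 1 Q with hQ1 | hQ1
  · have : 0 ≤ 2 * k * R := by positivity
    nlinarith
  -- The exponential sum linearised by exp(-c u_j) ≥ 1 - c u_j.
  set S := ∑ i, ∑ j, if i < j then (1 + u i) * (1 - c * u j) else 0 with hS
  have hRS : Real.exp (-c) * S ≤ k * R := by
    rw [hS, hR, mul_sum, mul_sum]
    refine sum_le_sum fun i _ => ?_
    rw [mul_sum, mul_sum]
    refine sum_le_sum fun j _ => ?_
    split_ifs
    · have h1 : c * k * a j = c + c * u j := by rw [hu]; field_simp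
      have h2 : k * (a i * Real.exp (-(c * k * a j))) =
          Real.exp (-c) * ((1 + u i) * Real.exp (-(c * u j))) := by
        rw [h1, neg_add, Real.exp_add, hu i]
        field_simp
      have h3 : 0 ≤ 1 + u i := by
        have := ha0 i
        rw [hu i] at this
        by_contra! hcon
        exact absurd (div_neg_of_neg_of_pos hcon hk') (not_lt.2 this)
      rw [h2]
      gcongr
      linarith [Real.add_one_le_exp (-(c * u j))]
    · simp
  have hSval : S = k * (k - 1) / 2 - (1 + c) * ∑ i : Fin k, (i : ℕ) * u i + c * Q / 2 := by
    have e1 : S = ∑ i : Fin k, ∑ j, (if i < j then (1 : ℝ) else 0) +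
        ∑ i, ∑ j, (if i < j then u i else 0) - c * ∑ i, ∑ j, (if i < j then u j else 0) -
        c * ∑ i, ∑ j, (if i < j then u i * u j else 0) := by
      simp only [hS, mul_sum, ← sum_add_distrib, ← sum_sub_distrib]
      refine sum_congr rfl fun i _ => sum_congr rfl fun j _ => ?_
      split_ifs
      · ring
      · simp
    have e2 := two_mul_sum_sum_ite_lt_mul u
    have e3 := two_mul_sum_sum_ite_lt_mul (fun _ : Fin k => (1 : ℝ))
    simp only [mul_one, one_pow, sum_const, card_univ, Fintype.card_fin, nsmul_eq_mul] at e3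
    rw [hu0, ← hQ] at e2
    have e4 : ∑ i : Fin k, ((k : ℝ) - 1 - (i : ℕ)) * u i = -∑ i : Fin k, (i : ℕ) * u i := by
      simp only [sub_mul _ ((_ : ℕ) : ℝ), sum_sub_distrib, ← mul_sum, hu0, mul_zero, zero_sub]
    rw [e1, sum_sum_ite_lt_left u, sum_sum_ite_lt_right u, e4]
    linear_combination (1 / 2) * e3 - (c / 2) * e2
  -- Cauchy–Schwarz, using Q < 1.
  have hCS : ∑ i : Fin k, (i : ℕ) * u i ≤ k * √k := by
    have h1 := sum_mul_sq_le_sq_mul_sq univ (fun i : Fin k => ((i : ℕ) : ℝ)) u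
    have h2 : ∑ i : Fin k, ((i : ℕ) : ℝ) ^ 2 ≤ k * k ^ 2 := by
      calc _ ≤ ∑ _i : Fin k, (k : ℝ) ^ 2 := by
            refine sum_le_sum fun i _ => ?_
            gcongr
            exact i.2.le
        _ = _ := by simp
    refine (le_abs_self _).trans (abs_le_of_sq_le_sq ?_ (by positivity))
    rw [mul_pow, Real.sq_sqrt hk'.le]
    rw [← hQ] at h1
    have h4 : (0 : ℝ) ≤ ∑ i : Fin k, ((i : ℕ) : ℝ) ^ 2 := sum_nonneg fun _ _ => sq_nonneg _
    nlinarith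
  have hSlow : k * (k - 1) / 2 - (1 + c) * (k * √k) ≤ S := by
    have h1 : (1 + c) * ∑ i : Fin k, (i : ℕ) * u i ≤ (1 + c) * (k * √k) := by gcongr
    have h2 : 0 ≤ c * Q / 2 := by positivity
    rw [hSval]
    linarith
  have h5 := mul_le_mul_of_nonneg_left hSlow (Real.exp_pos (-c)).le
  have h6 : 0 ≤ c * Q := by positivity
  linarith

theorem log_one_sub_le {x : ℝ} (h0 : 0 ≤ x) (h1 : x < 1) :
    Real.log (1 - x) ≤ -x - x ^ 2 / 2 := by
  have h := Real.hasSum_pow_div_log_of_abs_lt_one (x := x) (by rwa [abs_of_nonneg h0])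
  have h2 := sum_le_hasSum (range 2) (fun i _ => by positivity) h
  norm_num [sum_range_succ] at h2
  linarith

/-- The second-order term matters: multiplied by d/2 ≈ k ln k it produces the -ln k of the
threshold. -/
theorem log_one_sub_inv_le {k : ℕ} (hk : 2 ≤ k) :
    Real.log (1 - 1 / k) ≤ -((2 * k + 1) / (2 * (k : ℝ) ^ 2)) := by
  have hk' : (2 : ℝ) ≤ k := by exact_mod_cast hk
  refine (log_one_sub_le (by positivity) ?_).trans_eq ?_
  · rw [div_lt_one] <;> linarith
  · field_simp
    ring

/-- The choice y = dk/(k-1) minimises y(1 - 1/k)/2 - (d/2) ln y, the part of the exponent depending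
on y at equal densities when the rigidity gain is ignored. -/
theorem gnmWhp_not_colorable_of_rate_bound (hk : 2 ≤ k) {d B : ℝ} (hd : 0 < d)
    (hB : ∀ a : Fin k → ℝ, (∀ i, 0 ≤ a i) → ∑ i, a i = 1 →
      rigidRate (d / (k - 1) * k) a ≤ d / (k - 1) * (k - 1) / 2 - B)
    (hneg : Real.log k - d * ((2 * k + 1) / (4 * (k : ℝ) ^ 2)) - B < 0) :
    GnmWhp (fun n => ⌈d * (n : ℝ) / 2⌉₊) (fun _ G => ¬ G.Colorable k) := by
  have hk' : (2 : ℝ) ≤ k := by exact_mod_cast hk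
  have hk1 : (0 : ℝ) < k - 1 := by linarith
  refine gnmWhp_not_colorable_of_rate (by omega) hd (y := d / (k - 1) * k) (by positivity) hB ?_
  have e : d / (d / (k - 1) * k) = 1 - 1 / (k : ℝ) := by field_simp
  have h1 := mul_le_mul_of_nonneg_left (log_one_sub_inv_le hk) (half_pos hd).le
  have e2 : d / 2 * -((2 * k + 1) / (2 * (k : ℝ) ^ 2)) =
      -(d * ((2 * k + 1) / (4 * (k : ℝ) ^ 2))) := by
    field_simp
    ring
  rw [e, div_mul_cancel₀ _ hk1.ne']
  linarith

theorem one_lt_log_of_three_le (hk : 3 ≤ k) : 1 < Real.log k := by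
  rw [Real.lt_log_iff_exp_lt (by positivity)]
  have : (3 : ℝ) ≤ k := by exact_mod_cast hk
  linarith [Real.exp_one_lt_d9]

/-- Here the rigidity gain is not needed. This leaves a bounded window of d, on which c = 2 ln k +
o(1) as k grows. -/
theorem gnmWhp_not_colorable_of_large (hk : 3 ≤ k) {d : ℝ}
    (hd : 2 * (k : ℝ) * Real.log k - Real.log k + 1 < d) :
    GnmWhp (fun n => ⌈d * (n : ℝ) / 2⌉₊) (fun _ G => ¬ G.Colorable k) := by
  have hk' : (3 : ℝ) ≤ k := by exact_mod_cast hk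
  have hL := one_lt_log_of_three_le hk
  have hLk : Real.log k ≤ k := (Real.log_le_sub_one_of_pos (by linarith)).trans (by linarith)
  have hd0 : 0 < d := by nlinarith
  refine gnmWhp_not_colorable_of_rate_bound (by omega) hd0 (B := 0) (fun a ha0 ha => ?_) ?_
  · rw [sub_zero]
    exact rigidRate_le_half (div_nonneg hd0.le (by linarith)) (by omega) ha0 ha
  · rw [sub_zero, sub_neg, ← mul_div_assoc, lt_div_iff₀ (by positivity)]
    nlinarith

/-- Half of δ absorbs the loss in the rigidity gain, so τ = 1 - δ/2; the other half beats the
lower-order terms through `hδk`. The upper bound on d keeps e^(-c) k² near 1. -/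
theorem gnmWhp_not_colorable_of_mid (hk : 3 ≤ k) {d δ : ℝ} (hδ : 0 ≤ δ)
    (hδk : 1 + Real.log k ≤ δ * k)
    (hpos : 0 ≤ 1 - 1 / k - 2 * (1 + (2 * Real.log k + (Real.log k + 1) / (k - 1))) / √k)
    (hτ : 1 - δ / 2 ≤ Real.exp (-((Real.log k + 1) / (k - 1))) *
      (1 - 1 / k - 2 * (1 + (2 * Real.log k + (Real.log k + 1) / (k - 1))) / √k))
    (hd : 2 * (k : ℝ) * Real.log k - Real.log k - 1 + δ < d)
    (hd' : d ≤ 2 * (k : ℝ) * Real.log k - Real.log k + 1) :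
    GnmWhp (fun n => ⌈d * (n : ℝ) / 2⌉₊) (fun _ G => ¬ G.Colorable k) := by
  have hk' : (3 : ℝ) ≤ k := by exact_mod_cast hk
  have hk1 : (0 : ℝ) < k - 1 := by linarith
  have hL := one_lt_log_of_three_le hk
  have hd0 : 0 < d := by nlinarith
  have hc0 : 0 ≤ d / (k - 1 : ℝ) := by positivity
  have hc : d / (k - 1 : ℝ) ≤ 2 * Real.log k + (Real.log k + 1) / (k - 1) := by
    rw [div_le_iff₀ hk1, add_mul, div_mul_cancel₀ _ hk1.ne']
    linarith
  refine gnmWhp_not_colorable_of_rate_bound (by omega) hd0 (B := (1 - δ / 2) / (2 * k))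
    (fun a ha0 ha => rigidRate_le hc0 (by omega) ?_ ?_ ha0 ha) ?_
  · rw [le_div_iff₀ hk1]
    nlinarith
  · refine hτ.trans ?_
    have hsq : √(k : ℝ) * √k = k := Real.mul_self_sqrt (by linarith)
    have hs0 : 0 < √(k : ℝ) := Real.sqrt_pos.2 (by linarith)
    have hexp : Real.exp (-((Real.log k + 1) / (k - 1))) ≤
        Real.exp (-(d / (k - 1))) * (k : ℝ) ^ 2 := by
      have : (k : ℝ) ^ 2 = Real.exp (2 * Real.log k) := by
        rw [two_mul, Real.exp_add, Real.exp_log (by linarith), sq]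
      rw [this, ← Real.exp_add]
      gcongr
      linarith
    have e : (k : ℝ) * (k - 1) - 2 * (1 + d / (k - 1)) * (k * √k) =
        k ^ 2 * (1 - 1 / k - 2 * (1 + d / (k - 1)) / √k) := by
      generalize d / (k - 1 : ℝ) = c
      have h1 : (k : ℝ) ^ 2 / √k = k * √k := by
        rw [div_eq_iff hs0.ne', mul_assoc, hsq, sq]
      have h2 : (k : ℝ) ^ 2 * (1 / k) = k := by field_simp
      rw [mul_sub ((k : ℝ) ^ 2), mul_sub ((k : ℝ) ^ 2), h2, mul_div_assoc', mul_comm ((k : ℝ) ^ 2) (2 * (1 + c)),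
        mul_div_assoc, h1]
      ring
    rw [e, ← mul_assoc]
    refine mul_le_mul hexp ?_ hpos (by positivity)
    gcongr
  · have e : d * ((2 * k + 1) / (4 * (k : ℝ) ^ 2)) + (1 - δ / 2) / (2 * k) =
        (d * (2 * k + 1) + (1 - δ / 2) * (2 * k)) / (4 * (k : ℝ) ^ 2) := by
      field_simp
      ring
    rw [sub_sub, e, sub_neg, lt_div_iff₀ (by positivity)]
    nlinarith [mul_lt_mul_of_pos_right hd (show (0 : ℝ) < 2 * k + 1 by linarith)]

theorem tendsto_log_add_one_div_sub_one :
    Tendsto (fun k : ℕ => (Real.log k + 1) / ((k : ℝ) - 1)) atTop (𝓝 0) := by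
  have h0 : Tendsto (fun n : ℕ => 1 / (n : ℝ)) atTop (𝓝 0) := tendsto_one_div_atTop_nhds_zero_nat
  have hlog : Tendsto (fun n : ℕ => Real.log n / (n : ℝ)) atTop (𝓝 0) :=
    Real.isLittleO_log_id_atTop.tendsto_div_nhds_zero.comp tendsto_natCast_atTop_atTop
  have h := (hlog.add h0).div (h0.const_sub 1) (by norm_num)
  simp only [add_zero, sub_zero, div_one] at h
  refine h.congr' ?_
  filter_upwards [eventually_ge_atTop 2] with k hk
  have hk' : (2 : ℝ) ≤ k := by exact_mod_cast hk
  have : (0 : ℝ) < k - 1 := by linarith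
  simp only [Pi.div_apply]
  field_simp

theorem eventually_gnmWhp_not_colorable {δ : ℝ} (hδ : 0 < δ) :
    ∀ᶠ k : ℕ in atTop, ∀ d : ℝ, 2 * (k : ℝ) * Real.log k - Real.log k - 1 + δ < d →
      GnmWhp (fun n => ⌈d * (n : ℝ) / 2⌉₊) (fun _ G => ¬ G.Colorable k) := by
  have h0 : Tendsto (fun n : ℕ => 1 / (n : ℝ)) atTop (𝓝 0) := tendsto_one_div_atTop_nhds_zero_nat
  have hlog : Tendsto (fun n : ℕ => Real.log n / (n : ℝ)) atTop (𝓝 0) :=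
    Real.isLittleO_log_id_atTop.tendsto_div_nhds_zero.comp tendsto_natCast_atTop_atTop
  have hls : Tendsto (fun n : ℕ => Real.log n / √(n : ℝ)) atTop (𝓝 0) := by
    have := (isLittleO_log_rpow_atTop one_half_pos).tendsto_div_nhds_zero.comp
      tendsto_natCast_atTop_atTop
    refine this.congr fun n => ?_
    simp [Real.sqrt_eq_rpow]
  have hs : Tendsto (fun n : ℕ => (√(n : ℝ))⁻¹) atTop (𝓝 0) :=
    tendsto_inv_atTop_zero.comp (Real.tendsto_sqrt_atTop.comp tendsto_natCast_atTop_atTop)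
  have hr := tendsto_log_add_one_div_sub_one
  have hp : Tendsto (fun k : ℕ => 1 - 1 / (k : ℝ) -
      2 * (1 + (2 * Real.log k + (Real.log k + 1) / (k - 1))) / √k) atTop (𝓝 1) := by
    have h := (h0.const_sub 1).sub ((hs.add ((hls.const_mul 2).add (hr.mul hs))).const_mul 2)
    simp only [mul_zero, add_zero, sub_zero] at h
    refine h.congr fun k => ?_
    ring
  have hq := hr.neg.rexp.mul hp
  simp only [neg_zero, Real.exp_zero, mul_one] at hq
  have hlk := hlog.add h0
  rw [add_zero] at hlk
  filter_upwards [eventually_ge_atTop 3, hp.eventually (lt_mem_nhds one_pos),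
    hq.eventually (lt_mem_nhds (show 1 - δ / 2 < 1 by linarith)),
    hlk.eventually (gt_mem_nhds hδ)] with k hk hpk hqk hlk d hd
  have hk' : (0 : ℝ) < k := by exact_mod_cast (by omega : 0 < k)
  rcases le_or_gt d (2 * (k : ℝ) * Real.log k - Real.log k + 1) with h | h
  · refine gnmWhp_not_colorable_of_mid hk hδ.le ?_ hpk.le hqk.le hd h
    rw [← add_div, div_lt_iff₀ hk'] at hlk
    linarith
  · exact gnmWhp_not_colorable_of_large hk h

end RateBounds

/-! ### The error sequence, threshold sequences and the theorem. -/

/-- The least excess over `2k ln k - ln k - 1` above which `G(n, ⌈dn/2⌉)` is w.h.p. not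
`k`-colorable. -/
noncomputable def colExcess (k : ℕ) : ℝ :=
  sInf {δ : ℝ | 0 ≤ δ ∧ ∀ d : ℝ, 2 * (k : ℝ) * Real.log k - Real.log k - 1 + δ < d →
    GnmWhp (fun n => ⌈d * (n : ℝ) / 2⌉₊) (fun _ G => ¬ G.Colorable k)}

theorem colExcess_nonneg (k : ℕ) : 0 ≤ colExcess k :=
  Real.sInf_nonneg fun _ h => h.1

theorem tendsto_colExcess : Tendsto colExcess atTop (𝓝 0) := by
  rw [tendsto_order]
  refine ⟨fun a ha => .of_forall fun k => ha.trans_le (colExcess_nonneg k), fun a ha => ?_⟩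
  filter_upwards [eventually_gnmWhp_not_colorable (half_pos ha)] with k hk
  have h : colExcess k ≤ a / 2 := csInf_le ⟨0, fun _ h => h.1⟩ ⟨(half_pos ha).le, hk⟩
  linarith

theorem gnmWhp_not_colorable_of_colExcess_lt {k : ℕ} (hk : 3 ≤ k) {d : ℝ}
    (hd : 2 * (k : ℝ) * Real.log k - Real.log k - 1 + colExcess k < d) :
    GnmWhp (fun n => ⌈d * (n : ℝ) / 2⌉₊) (fun _ G => ¬ G.Colorable k) := by
  have hne : {δ : ℝ | 0 ≤ δ ∧ ∀ d : ℝ, 2 * (k : ℝ) * Real.log k - Real.log k - 1 + δ < d →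
      GnmWhp (fun n => ⌈d * (n : ℝ) / 2⌉₊) (fun _ G => ¬ G.Colorable k)}.Nonempty :=
    -- Excess 2 turns -1 into the +1 of `gnmWhp_not_colorable_of_large`.
    ⟨2, zero_le_two, fun d hd => gnmWhp_not_colorable_of_large hk (by linarith)⟩
  obtain ⟨δ, hδ, hlt⟩ := exists_lt_of_csInf_lt hne
    (show colExcess k < d - (2 * (k : ℝ) * Real.log k - Real.log k - 1) by linarith)
  exact hδ.2 d (by linarith)

/-- A sharp threshold sequence for `k`-colorability is eventually below any average degree
at which non-`k`-colorability holds w.h.p., up to an arbitrarily small error. -/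
theorem IsSharpColThreshold.eventually_le {k : ℕ} {D : ℕ → ℝ} (hD : IsSharpColThreshold k D)
    {d η : ℝ} (hd : 0 < d) (hη : 0 < η)
    (hnot : GnmWhp (fun n => ⌈d * (n : ℝ) / 2⌉₊) (fun _ G => ¬ G.Colorable k)) :
    ∀ᶠ n in atTop, D n ≤ d + η := by
  classical
  -- D may exceed d + η only for some n. Taking no edges at the other n keeps m below the threshold
  -- for all large n, so `colorable` applies and contradicts `hnot` wherever D n > d + η.
  let m : ℕ → ℕ := fun n => if D n ≤ d + η then 0 else ⌈d * (n : ℝ) / 2⌉₊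
  set ε : ℝ := η / (2 * (d + η))
  have hε : 0 < ε := by positivity
  have hε1 : (1 - ε) * (d + η) = d + η / 2 := by
    simp only [ε]
    field_simp
    ring
  have hε2 : 0 < 1 - ε := by
    by_contra! h
    have := mul_nonpos_of_nonpos_of_nonneg h (by positivity : 0 ≤ d + η)
    linarith
  have hm : ∀ᶠ n in atTop, m n ≤ n.choose 2 := by
    filter_upwards [eventually_ceil_le_choose_two hd.le] with n hn
    simp only [m]
    split_ifs
    · exact Nat.zero_le _
    · exact hn
  have hlt : ∀ᶠ n in atTop, 2 * (m n : ℝ) / (n : ℝ) < (1 - ε) * D n := by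
    have h2 : d / 2 < (d + η / 2) / 2 := by linarith
    filter_upwards [hD.pos, (tendsto_ceil_div hd.le).eventually (gt_mem_nhds h2)] with n hpos hn
    simp only [m]
    split_ifs with h
    · simpa using mul_pos hε2 hpos
    · rw [not_le] at h
      have h3 := mul_lt_mul_of_pos_left h hε2
      rw [mul_div_assoc]
      linarith
  have hcol := hD.colorable ε hε m hm hlt
  filter_upwards [hcol.eventually (lt_mem_nhds (show (1 / 2 : ℝ) < 1 by norm_num)),
    hnot.eventually (lt_mem_nhds (show (1 / 2 : ℝ) < 1 by norm_num)),
    eventually_ceil_le_choose_two hd.le] with n h1 h2 h3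
  by_contra hcon
  simp only [m, if_neg hcon] at h1
  rw [gnm_real_not h3] at h2
  linarith

/-- The limsup bound is spelled out with η because a real-valued `limsup` has a junk value on
unbounded sequences. -/
theorem theorem1 :
    ∃ ε : ℕ → ℝ, Tendsto ε atTop (𝓝 0) ∧
      ∀ k : ℕ, 3 ≤ k →
        (∀ d : ℝ, 2 * (k : ℝ) * Real.log k - Real.log k - 1 + ε k < d →
          GnmWhp (fun n => ⌈d * (n : ℝ) / 2⌉₊) (fun _ G => ¬ G.Colorable k)) ∧
        (∀ D : ℕ → ℝ, IsSharpColThreshold k D →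
          ∀ η : ℝ, 0 < η → ∀ᶠ n in atTop,
            D n ≤ 2 * (k : ℝ) * Real.log k - Real.log k - 1 + ε k + η) := by
  refine ⟨colExcess, tendsto_colExcess, fun k hk =>
    ⟨fun d hd => gnmWhp_not_colorable_of_colExcess_lt hk hd, fun D hD η hη => ?_⟩⟩
  have hk' : (3 : ℝ) ≤ k := by exact_mod_cast hk
  have hL := one_lt_log_of_three_le hk
  have h0 := colExcess_nonneg k
  have hpos : 0 < 2 * (k : ℝ) * Real.log k - Real.log k - 1 + colExcess k + η / 2 := by nlinarith
  filter_upwards [hD.eventually_le hpos (half_pos hη)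
    (gnmWhp_not_colorable_of_colExcess_lt hk (by linarith))] with n hn
  linarith
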